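/- Theorem. There is a universal constant $c>0$ such that the following holds. For every integer $d\ge 1$, every real $K\ge d$ and every real $\varepsilon>0$ there exist a probability distribution $D$ on a finite set $G$, a linear family $\mathcal F$ of functions $G\to\mathbb C$ of dimension $d$ whose condition number $$\sup_{h\in\mathcal F,\,h\neq 0}\ \sup_{x\in G}\frac{|h(x)|^2}{\|h\|_D^2},\qquad \|h\|_D:=\Big(\mathbb E_{x\sim D}|h(x)|^2\Big)^{1/2},$$ equals exactly $K$, and a random noise function $g$ (a probability law of $g(x)\in\mathbb C$ for each $x\in G$) with $0<\|g\|_D:=\big(\mathbb E_{x\sim D}\mathbb E_{g}|g(x)|^2\big)^{1/2}<\infty$ that is orthogonal to $\mathcal F$, i.e. $\mathbb E_{x\sim D}\mathbb E_{g}\big[\overline{h(x)}\,g(x)\big]=0$ for all $h\in\mathcal F$, such that every (possibly randomized) algorithm with the following property takes $m\ge c\,\big(K\log d+\frac{K}{\varepsilon}\big)$ samples. The algorithm observes $m$ independent samples $(x_i,y_i)$ with $x_i\sim D$ and $y_i=f(x_i)+g(x_i)$, the noise being drawn independently for each sample, and for every $f\in\mathcal F$ it outputs, with probability at least $\frac34$,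 a function $\widetilde f:G\to\mathbb C$ satisfying $$\|\widetilde f-f\|_D\le 0.1\sqrt{\varepsilon}\,\|g\|_D .$$ -/

import Mathlib

open MeasureTheory ProbabilityTheory
open scoped ENNReal ComplexConjugate

namespace ActiveRegression

variable {G : Type*} [MeasurableSpace G]

/-- The norm `‖f‖_D = (𝔼_{x ∼ D} |f x|²)^{1/2}`, with values in `[0, ∞]`. -/
noncomputable def normD (D : Measure G) (f : G → ℂ) : ℝ≥0∞ :=
  eLpNorm f 2 D

/-- The condition number `sup_{h ∈ F, h ≠ 0} sup_{x ∈ G} |h x|² / ‖h‖_D²` of a linear family `F`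
over `D`, with values in `[0, ∞]`. (A nonzero `h ∈ F` with `‖h‖_D = 0` makes it infinite.) -/
noncomputable def condNumber (D : Measure G) (F : Submodule ℂ (G → ℂ)) : ℝ≥0∞ :=
  ⨆ h ∈ F, ⨆ (_ : h ≠ 0), ⨆ x : G, ‖h x‖ₑ ^ 2 / normD D h ^ 2

/-- A randomized noise function `g` is given by the law `g x` on `ℂ` of the noise at each point `x`.
Its norm is `‖g‖_D = (𝔼_{x ∼ D, z ∼ g x} |z|²)^{1/2}`. -/
noncomputable def noiseNorm (D : Measure G) (g : Kernel G ℂ) : ℝ≥0∞ :=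
  eLpNorm (fun p : G × ℂ => p.2) 2 (D ⊗ₘ g)

/-- The noise `g` is orthogonal to the family `F` over `D`: it has finite norm, and
`𝔼_{x ∼ D, z ∼ g x} [conj (h x) * z] = 0` for every `h ∈ F`. -/
def NoiseOrthogonal (D : Measure G) (F : Submodule ℂ (G → ℂ)) (g : Kernel G ℂ) : Prop :=
  noiseNorm D g < ∞ ∧ ∀ h ∈ F, ∫ p : G × ℂ, conj (h p.1) * p.2 ∂(D ⊗ₘ g) = 0

/-- The law of one labelled sample `(x, y)`: `x ∼ D` and `y = f x + z` with `z ∼ g x`. -/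
noncomputable def labelledSample (D : Measure G) (g : Kernel G ℂ) (f : G → ℂ) :
    Measure (G × ℂ) :=
  (D ⊗ₘ g).map fun p => (p.1, f p.1 + p.2)

/-- The law of `m` independent labelled samples. -/
noncomputable def labelledSamples (D : Measure G) (g : Kernel G ℂ) (f : G → ℂ) (m : ℕ) :
    Measure (Fin m → G × ℂ) :=
  Measure.pi fun _ => labelledSample D g f

/-- A randomized algorithm `A` sends `m` labelled samples to the law of its output `f' : G → ℂ`
(which is not required to lie in `F`). It succeeds at accuracy `r` if, whatever the true
`f ∈ F` is, the output satisfies `‖f' - f‖_D ≤ r` with probability at least `3/4` over the samples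
and the internal randomness. -/
def Succeeds (D : Measure G) (F : Submodule ℂ (G → ℂ)) (g : Kernel G ℂ) (r : ℝ≥0∞) {m : ℕ}
    (A : Kernel (Fin m → G × ℂ) (G → ℂ)) : Prop :=
  ∀ f ∈ F, 3 / 4 ≤ ((labelledSamples D g f m).bind A) {f' | normD D (f' - f) ≤ r}

end ActiveRegression

/-! One instance is hard for two independent reasons. Take `d` atoms of mass `1 / K` and put the
remaining mass on the point `0`, where every function of the family vanishes. The values on the
atoms are then free. An atom's indicator attains the condition number `K`, and a sample hits any
given atom with probability only `1 / K`. The noise is a standard Gaussian on the single atom `1`,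
so `‖g‖_D = √(1/K)`. Both the error and the noise thus carry the factor `√(1/K)`, and success forces
an error of at most `0.1 √ε` at each atom.

Coverage gives `K log d`. A value at an unseen atom can only be guessed. With one hypothesis per
subset of the atoms, flipping membership of an unseen atom leaves the data unchanged, so success
with probability `3/4` forces all atoms to be seen with probability at least `1/2`
(`half_le_of_identifies`). A second moment bound on the number of unseen atoms (`coupon_collector`)
then bounds `m` below.

Noise gives `K / ε`. The hypotheses `0` and `a` times the indicator of atom `1`, with `a` of order
`√ε`, must be told apart. The likelihood ratio of one sample has second moment `1 + (exp (a²) - 1) /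
K`. Its `m`-th power must be at least `9/4` (`nine_fourths_le_lintegral_sq`), so for `ε ≤ 1` a
number of samples of order `K / ε` is needed. For `ε ≥ 1` coverage of one atom suffices. -/

namespace ActiveRegression

/-! ### Product measures and testing between hypotheses -/

section General

variable {ι E Ω X : Type*} [MeasurableSpace E] [MeasurableSpace Ω] [MeasurableSpace X]

theorem lintegral_pi_prod [Fintype ι] (μ : Measure E) [IsProbabilityMeasure μ]
    (φ : ι → E → ℝ≥0∞) (hφ : ∀ i, Measurable (φ i)) :
    ∫⁻ ω : ι → E, ∏ i, φ i (ω i) ∂(Measure.pi fun _ => μ) = ∏ i, ∫⁻ x, φ i x ∂μ := by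
  have hind : iIndepFun (fun (i : ι) (ω : ι → E) => φ i (ω i)) (Measure.pi fun _ => μ) :=
    iIndepFun_pi fun i => (hφ i).aemeasurable
  rw [lintegral_prod_eq_prod_lintegral_of_indepFun Finset.univ _ hind
    (fun i => (hφ i).comp (measurable_pi_apply i))]
  refine Finset.prod_congr rfl fun i _ => ?_
  exact (measurePreserving_eval (fun _ : ι => μ) i).lintegral_comp (hφ i)

theorem pi_withDensity [Fintype ι] (μ : Measure E) [IsProbabilityMeasure μ]
    (L : E → ℝ≥0∞) (hL : Measurable L) [IsProbabilityMeasure (μ.withDensity L)] :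
    Measure.pi (fun _ : ι => μ.withDensity L) =
      (Measure.pi fun _ : ι => μ).withDensity fun ω => ∏ i, L (ω i) := by
  refine Measure.pi_eq fun s hs => ?_
  rw [withDensity_apply _ (MeasurableSet.univ_pi hs),
    ← lintegral_indicator (MeasurableSet.univ_pi hs)]
  have h : ((Set.univ.pi s).indicator fun ω : ι → E => ∏ i, L (ω i)) =
      fun ω => ∏ i, (s i).indicator L (ω i) := by
    classical
    funext ω
    by_cases hω : ω ∈ Set.univ.pi s
    · rw [Set.indicator_of_mem hω]
      exact Finset.prod_congr rfl fun i _ =>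
        (Set.indicator_of_mem (hω i (Set.mem_univ i)) L).symm
    · rw [Set.indicator_of_notMem hω]
      simp only [Set.mem_univ_pi, not_forall] at hω
      obtain ⟨i, hi⟩ := hω
      exact (Finset.prod_eq_zero (Finset.mem_univ i) (Set.indicator_of_notMem hi L)).symm
  rw [h, lintegral_pi_prod μ _ fun i => hL.indicator (hs i)]
  exact Finset.prod_congr rfl fun i _ => by
    rw [lintegral_indicator (hs i), withDensity_apply _ (hs i)]

/-- Expand `(l - 3p)² ≥ 0` and use `p² ≤ p`. This linearises Cauchy–Schwarz; the factor `3` is the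
ratio of the test's two probabilities, `3/4` and `1/4`, which makes it lossless there. -/
theorem six_mul_mul_le_sq_add (l p : ℝ≥0∞) (hp : p ≤ 1) : 6 * (l * p) ≤ l ^ 2 + 9 * p := by
  by_cases hl : l = ∞
  · simp [hl]
  lift l to NNReal using hl
  lift p to NNReal using ne_top_of_le_ne_top ENNReal.one_ne_top hp
  norm_cast at hp ⊢
  rw [← NNReal.coe_le_coe] at hp ⊢
  push_cast at hp ⊢
  nlinarith [sq_nonneg ((l : ℝ) - 3 * p), p.2, mul_nonneg p.2 (sub_nonneg.2 hp)]

/-- If a test distinguishes `P` from the law of density `L` relative to `P`, each with probability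
at least `3/4`, then the second moment of `L` is at least `9/4`. -/
theorem nine_fourths_le_lintegral_sq (P : Measure Ω) [IsProbabilityMeasure P]
    (A : Kernel Ω X) [IsMarkovKernel A] (L : Ω → ℝ≥0∞) (hL : Measurable L) {S T : Set X}
    (hS : MeasurableSet S) (hT : MeasurableSet T) (hST : Disjoint S T)
    (h₁ : 3 / 4 ≤ P.bind A S) (h₂ : 3 / 4 ≤ (P.withDensity L).bind A T) :
    9 / 4 ≤ ∫⁻ ω, L ω ^ 2 ∂P := by
  rw [Measure.bind_apply hS A.measurable.aemeasurable] at h₁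
  rw [Measure.bind_apply hT A.measurable.aemeasurable,
    lintegral_withDensity_eq_lintegral_mul _ hL (A.measurable_coe hT)] at h₂
  have hAS := A.measurable_coe hS
  have hAT := A.measurable_coe hT
  have hsum : ∫⁻ ω, A ω S ∂P + ∫⁻ ω, A ω T ∂P ≤ 1 := by
    rw [← lintegral_add_left hAS]
    calc ∫⁻ ω, A ω S + A ω T ∂P ≤ ∫⁻ _, 1 ∂P := lintegral_mono fun ω => by
          rw [← measure_union hST hT]; exact prob_le_one
      _ = 1 := by simp
  have hT' : ∫⁻ ω, A ω T ∂P ≤ 1 / 4 := by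
    have h : (3 / 4 : ℝ≥0∞) + ∫⁻ ω, A ω T ∂P ≤ 3 / 4 + 1 / 4 := by
      refine (add_le_add_left h₁ _).trans (hsum.trans_eq ?_)
      rw [← ENNReal.add_div]
      norm_num
      exact (ENNReal.div_self (by norm_num) (by norm_num)).symm
    exact (ENNReal.add_le_add_iff_left (by finiteness)).1 h
  have key : 6 * (3 / 4 : ℝ≥0∞) ≤ ∫⁻ ω, L ω ^ 2 ∂P + 9 * (1 / 4) :=
    calc 6 * (3 / 4 : ℝ≥0∞) ≤ 6 * ∫⁻ ω, L ω * A ω T ∂P := by gcongr; exact h₂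
      _ = ∫⁻ ω, 6 * (L ω * A ω T) ∂P := (lintegral_const_mul _ (hL.mul hAT)).symm
      _ ≤ ∫⁻ ω, L ω ^ 2 + 9 * A ω T ∂P :=
          lintegral_mono fun ω => six_mul_mul_le_sq_add _ _ prob_le_one
      _ = ∫⁻ ω, L ω ^ 2 ∂P + 9 * ∫⁻ ω, A ω T ∂P := by
          rw [lintegral_add_left (hL.pow_const 2), lintegral_const_mul _ hAT]
      _ ≤ _ := by gcongr
  have e : 6 * (3 / 4 : ℝ≥0∞) = 9 / 4 + 9 * (1 / 4) := by
    rw [← ENNReal.toReal_eq_toReal_iff' (by finiteness) (by finiteness)]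
    rw [ENNReal.toReal_add (by finiteness) (by finiteness)]
    simp
    norm_num
  rw [e] at key
  exact (ENNReal.add_le_add_iff_right (by finiteness)).1 key

/-- If outside the event `U` the data do not distinguish each hypothesis from some other one, then
an algorithm that identifies every hypothesis with probability at least `3/4` forces
`P U ≥ 1/2`. -/
theorem half_le_of_identifies {Θ Y : Type*} [Fintype Θ] [Nonempty Θ] [MeasurableSpace Y]
    (P : Measure Ω) [IsProbabilityMeasure P] (data : Θ → Ω → Y) (hdata : ∀ t, Measurable (data t))
    (A : Kernel Y X) [IsMarkovKernel A] (S : Θ → Set X) (hS : ∀ t, MeasurableSet (S t))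
    (hdisj : ∀ s t, s ≠ t → Disjoint (S s) (S t)) {U : Set Ω} (hU : MeasurableSet U)
    (hmiss : ∀ ω ∉ U, ∃ σ : Θ → Θ, Function.Involutive σ ∧ (∀ t, σ t ≠ t) ∧
      ∀ t, data (σ t) ω = data t ω)
    (h : ∀ t, 3 / 4 ≤ (P.map (data t)).bind A (S t)) :
    1 / 2 ≤ P.real U := by
  set φ : Θ → Ω → ℝ := fun t ω => (A (data t ω)).real (S t)
  have hφm : ∀ t, Measurable (φ t) := fun t =>
    ((A.measurable_coe (hS t)).comp (hdata t)).ennreal_toReal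
  have hφ0 : ∀ t ω, 0 ≤ φ t ω := fun t ω => measureReal_nonneg
  have hφ1 : ∀ t ω, φ t ω ≤ 1 := fun t ω => measureReal_le_one
  have hint : ∀ t, Integrable (φ t) P := fun t =>
    Integrable.of_bound (hφm t).aestronglyMeasurable 1 (.of_forall fun ω => by
      rw [Real.norm_eq_abs, abs_of_nonneg (hφ0 t ω)]; exact hφ1 t ω)
  have hφ : ∀ t, 3 / 4 ≤ ∫ ω, φ t ω ∂P := fun t => by
    have := h t
    rw [Measure.bind_apply (hS t) A.measurable.aemeasurable,
      lintegral_map (A.measurable_coe (hS t)) (hdata t)] at this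
    have e : ∫⁻ ω, A (data t ω) (S t) ∂P = ENNReal.ofReal (∫ ω, φ t ω ∂P) := by
      rw [ofReal_integral_eq_lintegral_ofReal (hint t) (.of_forall (hφ0 t))]
      exact lintegral_congr fun ω => (ofReal_measureReal).symm
    rw [e] at this
    have h34 : (3 / 4 : ℝ≥0∞) = ENNReal.ofReal (3 / 4) := by
      rw [ENNReal.ofReal_div_of_pos (by norm_num)]; norm_num
    rw [h34] at this
    exact (ENNReal.ofReal_le_ofReal_iff (integral_nonneg (hφ0 t))).1 this
  have hpt : ∀ ω, ∑ t, φ t ω ≤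
      (Fintype.card Θ : ℝ) * (1 / 2 + U.indicator (fun _ => (1 / 2 : ℝ)) ω) := fun ω => by
    by_cases hω : ω ∈ U
    · rw [Set.indicator_of_mem hω]
      calc ∑ t, φ t ω ≤ ∑ _t : Θ, (1 : ℝ) := Finset.sum_le_sum fun t _ => hφ1 t ω
        _ = _ := by simp; norm_num
    · rw [Set.indicator_of_notMem hω]
      -- For fixed `ω`, `t` and `σ t` give the algorithm the same input, and their target sets are
      -- disjoint. Their success probabilities therefore sum to at most `1`, and the average over
      -- all hypotheses is at most `1/2`.
      obtain ⟨σ, hσ, hne, hd⟩ := hmiss ω hω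
      have e : ∑ t, φ (σ t) ω = ∑ t, φ t ω :=
        Equiv.sum_comp (Function.Involutive.toPerm σ hσ) (fun t => φ t ω)
      have hle : ∑ t, (φ t ω + φ (σ t) ω) ≤ ∑ _t : Θ, (1 : ℝ) :=
        Finset.sum_le_sum fun t _ => by
          simp only [φ, hd t]
          rw [← measureReal_union (hdisj _ _ (hne t).symm) (hS _)]
          exact measureReal_le_one
      rw [Finset.sum_add_distrib, e] at hle
      simp at hle
      linarith
  have hcard : (0 : ℝ) < Fintype.card Θ := by exact_mod_cast Fintype.card_pos
  have hfin : (Fintype.card Θ : ℝ) * (3 / 4) ≤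
      (Fintype.card Θ : ℝ) * (1 / 2 + P.real U * (1 / 2)) :=
    calc (Fintype.card Θ : ℝ) * (3 / 4) = ∑ _t : Θ, (3 / 4 : ℝ) := by simp
      _ ≤ ∑ t, ∫ ω, φ t ω ∂P := Finset.sum_le_sum fun t _ => hφ t
      _ = ∫ ω, ∑ t, φ t ω ∂P := (integral_finsetSum _ fun t _ => hint t).symm
      _ ≤ ∫ ω, (Fintype.card Θ : ℝ) * (1 / 2 + U.indicator (fun _ => (1 / 2 : ℝ)) ω) ∂P :=
          integral_mono (integrable_finsetSum _ fun t _ => hint t)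
            (((integrable_const _).add ((integrable_const _).indicator hU)).const_mul _) hpt
      _ = _ := by
          rw [integral_const_mul, integral_add (integrable_const _)
            ((integrable_const _).indicator hU), integral_indicator_const _ hU]
          simp
  have := le_of_mul_le_mul_left hfin hcard
  linarith

end General

/-! ### Coupon collecting -/

section Coupon

variable {ι E : Type*} [MeasurableSpace E]

theorem measurableSet_forall_exists_mem [Countable ι] {m : ℕ} {B : ι → Set E} (hB : ∀ i, MeasurableSet (B i)) :
    MeasurableSet {ω : Fin m → E | ∀ i, ∃ j, ω j ∈ B i} := by
  have : {ω : Fin m → E | ∀ i, ∃ j, ω j ∈ B i} = ⋂ i, ⋃ j, (fun ω => ω j) ⁻¹' B i := by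
    ext; simp
  rw [this]
  exact .iInter fun i => .iUnion fun j => measurable_pi_apply j (hB i)

theorem pi_real_univ_pi_const (μ : Measure E) [IsProbabilityMeasure μ] (m : ℕ) (s : Set E) :
    (Measure.pi fun _ : Fin m => μ).real (Set.univ.pi fun _ => s) = μ.real s ^ m := by
  simp [measureReal_def, Measure.pi_pi]

/-- Coupon collector: the second moment bound for the number of unseen coupons. -/
theorem coupon_collector [Fintype ι] (μ : Measure E) [IsProbabilityMeasure μ] (m : ℕ) {B : ι → Set E}
    (hB : ∀ i, MeasurableSet (B i)) (hdisj : Pairwise fun i k => Disjoint (B i) (B k)) {p : ℝ}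
    (hp : ∀ i, μ.real (B i) = p) (hp1 : p ≤ 1) :
    (Measure.pi fun _ : Fin m => μ).real {ω | ∀ i, ∃ j, ω j ∈ B i} ≤
      1 / (1 + Fintype.card ι * (1 - p) ^ m) := by
  classical
  set P := Measure.pi fun _ : Fin m => μ
  set q := (1 - p) ^ m
  have hq : 0 ≤ q := pow_nonneg (by linarith) m
  let V : ι → Set (Fin m → E) := fun i => Set.univ.pi fun _ => (B i)ᶜ
  have hV : ∀ i, MeasurableSet (V i) := fun i => .univ_pi fun _ => (hB i).compl
  have hV1 : ∀ i, P.real (V i) = q := fun i => by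
    rw [pi_real_univ_pi_const, probReal_compl_eq_one_sub (hB i), hp]
  have hV2 : ∀ i k, P.real (V i ∩ V k) ≤ q ^ 2 + if i = k then q else 0 := fun i k => by
    by_cases hik : i = k
    · subst hik
      rw [Set.inter_self, hV1, if_pos rfl]
      nlinarith [sq_nonneg q]
    · have e : V i ∩ V k = Set.univ.pi fun _ => (B i ∪ B k)ᶜ := by
        rw [Set.compl_union, Set.pi_inter_distrib]
      have h0 : μ.real (B i ∪ B k)ᶜ = 1 - (p + p) := by
        rw [probReal_compl_eq_one_sub ((hB i).union (hB k)),
          measureReal_union (hdisj hik) (hB k), hp, hp]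
      rw [e, pi_real_univ_pi_const, if_neg hik, add_zero, h0, ← pow_mul, mul_comm m 2, pow_mul]
      -- Missing two distinct coupons is negatively correlated: `1 - 2p ≤ (1 - p)²`.
      exact pow_le_pow_left₀ (h0 ▸ measureReal_nonneg) (by nlinarith [sq_nonneg p]) m
  have hE := measurableSet_forall_exists_mem (m := m) hB
  set N : ℝ := ((Fintype.card ι : ℕ) : ℝ)
  have hN : 0 ≤ N := Nat.cast_nonneg _
  -- With `Z` the number of unseen coupons, the indicator of `Z = 0` is at most `(1 - tZ)²`. This
  -- `t` minimises the resulting bound `1 - 2tNq + t²((Nq)² + Nq)`, and the minimum is `t` itself.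
  set t : ℝ := 1 / (1 + N * q)
  have hden : 0 < 1 + N * q := by positivity
  let J : Set (Fin m → E) → (Fin m → E) → ℝ := fun s => s.indicator fun _ => 1
  have hJ : ∀ s, MeasurableSet s → Integrable (J s) P := fun s hs =>
    (integrable_const 1).indicator hs
  have hJi : ∀ s, MeasurableSet s → ∫ ω, J s ω ∂P = P.real s := fun s hs => by
    simp [J, integral_indicator_const _ hs]
  have hpt : ∀ ω, J {ω | ∀ i, ∃ j, ω j ∈ B i} ω ≤
      1 - 2 * t * ∑ i, J (V i) ω + t ^ 2 * ∑ i, ∑ k, J (V i ∩ V k) ω := fun ω => by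
    have e : ∑ i, ∑ k, J (V i ∩ V k) ω = (∑ i, J (V i) ω) ^ 2 := by
      rw [sq, Finset.sum_mul_sum]
      refine Finset.sum_congr rfl fun i _ => Finset.sum_congr rfl fun k _ => ?_
      simp only [J, Set.indicator, Set.mem_inter_iff]
      split_ifs <;> simp_all
    rw [e]
    by_cases hω : ω ∈ {ω : Fin m → E | ∀ i, ∃ j, ω j ∈ B i}
    · have h0 : ∑ i, J (V i) ω = 0 := Finset.sum_eq_zero fun i _ => by
        refine Set.indicator_of_notMem (fun hi => ?_) _
        obtain ⟨j, hj⟩ := hω i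
        exact hi j (Set.mem_univ j) hj
      rw [h0]
      simp [J, Set.indicator_of_mem hω]
    · simp only [J, Set.indicator_of_notMem hω]
      nlinarith [sq_nonneg (1 - t * ∑ i, J (V i) ω)]
  have hs1 : Integrable (fun ω => ∑ i, J (V i) ω) P :=
    integrable_finsetSum _ fun i _ => hJ _ (hV i)
  have hs2 : Integrable (fun ω => ∑ i, ∑ k, J (V i ∩ V k) ω) P :=
    integrable_finsetSum _ fun i _ => integrable_finsetSum _ fun k _ =>
      hJ _ ((hV i).inter (hV k))
  have hle := integral_mono (hJ _ hE)
    (((integrable_const 1).sub (hs1.const_mul (2 * t))).add (hs2.const_mul (t ^ 2))) hpt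
  rw [hJi _ hE] at hle
  refine hle.trans ?_
  have i1 : ∫ ω, ∑ i, J (V i) ω ∂P = N * q := by
    rw [integral_finsetSum _ fun i _ => hJ _ (hV i)]
    simp [hJi _ (hV _), hV1, N]
  have i2 : ∫ ω, ∑ i, ∑ k, J (V i ∩ V k) ω ∂P ≤ (N * q) ^ 2 + N * q := by
    rw [integral_finsetSum _ fun i _ => integrable_finsetSum _ fun k _ =>
      hJ _ ((hV i).inter (hV k))]
    calc _ = ∑ i, ∑ k, P.real (V i ∩ V k) := Finset.sum_congr rfl fun i _ => by
          rw [integral_finsetSum _ fun k _ => hJ _ ((hV i).inter (hV k))]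
          exact Finset.sum_congr rfl fun k _ => hJi _ ((hV i).inter (hV k))
      _ ≤ ∑ i : ι, ∑ k : ι, (q ^ 2 + if i = k then q else 0) :=
          Finset.sum_le_sum fun i _ => Finset.sum_le_sum fun k _ => hV2 i k
      _ = _ := by simp [Finset.sum_add_distrib, N]; ring
  have e : ∫ ω, (1 - 2 * t * ∑ i, J (V i) ω + t ^ 2 * ∑ i, ∑ k, J (V i ∩ V k) ω) ∂P =
      1 - 2 * t * (N * q) + t ^ 2 * ∫ ω, ∑ i, ∑ k, J (V i ∩ V k) ω ∂P := by
    have hs3 : Integrable (fun ω => 1 - 2 * t * ∑ i, J (V i) ω) P :=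
      (integrable_const 1).sub (hs1.const_mul (2 * t))
    rw [integral_add hs3 (hs2.const_mul (t ^ 2)),
      integral_sub (integrable_const 1) (hs1.const_mul (2 * t)), integral_const_mul,
      integral_const_mul, i1]
    simp
  calc _ = 1 - 2 * t * (N * q) + t ^ 2 * ∫ ω, ∑ i, ∑ k, J (V i ∩ V k) ω ∂P := e
    _ ≤ 1 - 2 * t * (N * q) + t ^ 2 * ((N * q) ^ 2 + N * q) := by gcongr
    _ = t := by simp only [t]; field_simp; ring

theorem pi_real_forall_exists_mem_le (μ : Measure E) [IsProbabilityMeasure μ] (m : ℕ)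
    {B : ι → Set E} (i : ι) :
    (Measure.pi fun _ : Fin m => μ).real {ω | ∀ i, ∃ j, ω j ∈ B i} ≤ m * μ.real (B i) := by
  calc _ ≤ (Measure.pi fun _ : Fin m => μ).real (⋃ j, (fun ω => ω j) ⁻¹' B i) :=
        measureReal_mono fun ω hω => by simpa using hω i
    _ ≤ ∑ j : Fin m, (Measure.pi fun _ : Fin m => μ).real ((fun ω => ω j) ⁻¹' B i) :=
        measureReal_iUnion_fintype_le _
    _ ≤ ∑ _j : Fin m, μ.real (B i) := Finset.sum_le_sum fun j _ => by
        have hle := Measure.le_map_apply (μ := Measure.pi fun _ : Fin m => μ)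
          (f := fun ω => ω j) (measurable_pi_apply j).aemeasurable (B i)
        rw [(measurePreserving_eval (fun _ : Fin m => μ) j).map_eq] at hle
        exact ENNReal.toReal_mono (measure_ne_top _ _) hle
    _ = _ := by simp

end Coupon

/-! ### Laws of labelled samples -/

section Samples

variable {G : Type*} [MeasurableSpace G]

theorem measurable_shift {f : G → ℂ} (hf : Measurable f) :
    Measurable fun p : G × ℂ => (p.1, f p.1 + p.2) := by fun_prop

theorem labelledSamples_eq_map (D : Measure G) [IsProbabilityMeasure D] (g : Kernel G ℂ)
    [IsMarkovKernel g] {f : G → ℂ} (hf : Measurable f) (m : ℕ) :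
    labelledSamples D g f m = (Measure.pi fun _ : Fin m => D ⊗ₘ g).map
      fun ω j => ((ω j).1, f (ω j).1 + (ω j).2) := by
  have : IsProbabilityMeasure (labelledSample D g f) :=
    Measure.isProbabilityMeasure_map (measurable_shift hf).aemeasurable
  exact (Measure.pi_map_pi (μ := fun _ : Fin m => D ⊗ₘ g)
    (hμ := fun _ => inferInstanceAs (SigmaFinite (labelledSample D g f)))
    (f := fun _ p => (p.1, f p.1 + p.2)) fun _ => (measurable_shift hf).aemeasurable).symm

theorem labelledSample_eq_withDensity (D : Measure G) [IsProbabilityMeasure D] (g : Kernel G ℂ)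
    [IsMarkovKernel g] {f : G → ℂ} (hf : Measurable f) {L : G × ℂ → ℝ≥0∞} (hL : Measurable L)
    (h : ∀ x, (g x).map (f x + ·) = (g x).withDensity fun z => L (x, z)) :
    labelledSample D g f = (D ⊗ₘ g).withDensity L := by
  ext s hs
  rw [labelledSample, Measure.map_apply (measurable_shift hf) hs,
    Measure.compProd_apply (measurable_shift hf hs), withDensity_apply _ hs,
    ← lintegral_indicator hs, Measure.lintegral_compProd (hL.indicator hs)]
  refine lintegral_congr fun x => ?_
  have hsx : MeasurableSet (Prod.mk x ⁻¹' s) := measurable_prodMk_left hs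
  have := congrArg (fun ν => ν (Prod.mk x ⁻¹' s)) (h x)
  rw [Measure.map_apply (measurable_const_add _) hsx, withDensity_apply _ hsx,
    ← lintegral_indicator hsx] at this
  exact this

theorem labelledSample_zero (D : Measure G) (g : Kernel G ℂ) :
    labelledSample D g 0 = D ⊗ₘ g := by
  simp [labelledSample]

end Samples

/-! ### Gaussian noise and its shifts -/

section Gaussian

/-- The standard real Gaussian distribution, as a law on `ℂ`. -/
noncomputable def gaussianLaw : Measure ℂ := (gaussianReal 0 1).map fun t : ℝ => (t : ℂ)

instance : IsProbabilityMeasure gaussianLaw :=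
  Measure.isProbabilityMeasure_map Complex.measurable_ofReal.aemeasurable

/-- The density of the standard Gaussian distribution shifted by `a` relative to the unshifted
one. -/
noncomputable def gaussianRatio (a : ℝ) (z : ℂ) : ℝ≥0∞ :=
  ENNReal.ofReal (Real.exp (a * z.re - a ^ 2 / 2))

theorem measurable_gaussianRatio (a : ℝ) : Measurable (gaussianRatio a) := by
  unfold gaussianRatio; fun_prop

theorem gaussianLaw_map_add (a : ℝ) :
    gaussianLaw.map ((a : ℂ) + ·) = gaussianLaw.withDensity (gaussianRatio a) := by
  have h1 : gaussianReal a 1 = (gaussianReal 0 1).withDensity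
      fun t => ENNReal.ofReal (Real.exp (a * t - a ^ 2 / 2)) := by
    rw [gaussianReal_of_var_ne_zero _ one_ne_zero, gaussianReal_of_var_ne_zero _ one_ne_zero,
      ← withDensity_mul _ (measurable_gaussianPDF _ _) (by fun_prop)]
    congr 1
    funext t
    rw [Pi.mul_apply, gaussianPDF, gaussianPDF, ← ENNReal.ofReal_mul (gaussianPDFReal_nonneg _ _ _)]
    simp only [gaussianPDFReal]
    rw [mul_assoc _ (Real.exp _) (Real.exp _), ← Real.exp_add]
    congr 3
    simp
    ring
  ext s hs
  rw [withDensity_apply _ hs, ← lintegral_indicator hs, gaussianLaw,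
    lintegral_map ((measurable_gaussianRatio a).indicator hs) Complex.measurable_ofReal,
    Measure.map_map (measurable_const_add _) Complex.measurable_ofReal]
  have e : ((a : ℂ) + ·) ∘ (fun t : ℝ => (t : ℂ)) = (fun t : ℝ => (t : ℂ)) ∘ (a + ·) := by
    funext t; simp
  rw [e, ← Measure.map_map Complex.measurable_ofReal (measurable_const_add _),
    gaussianReal_map_const_add, zero_add, Measure.map_apply Complex.measurable_ofReal hs, h1,
    withDensity_apply _ (Complex.measurable_ofReal hs),
    ← lintegral_indicator (Complex.measurable_ofReal hs)]
  refine lintegral_congr fun t => ?_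
  simp only [Set.indicator, gaussianRatio, Complex.ofReal_re]
  rfl

theorem lintegral_gaussianRatio_sq (a : ℝ) :
    ∫⁻ z, gaussianRatio a z ^ 2 ∂gaussianLaw = ENNReal.ofReal (Real.exp (a ^ 2)) := by
  rw [gaussianLaw, lintegral_map ((measurable_gaussianRatio a).pow_const 2)
    Complex.measurable_ofReal]
  have hmgf := mgf_gaussianReal (p := gaussianReal 0 1) (X := id) (μ := 0) (v := 1) (by simp)
    (2 * a)
  have hint : Integrable (fun t : ℝ => Real.exp (2 * a * t)) (gaussianReal 0 1) :=
    integrable_exp_mul_gaussianReal _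
  have e : ∀ t : ℝ, gaussianRatio a t ^ 2 =
      ENNReal.ofReal (Real.exp (-a ^ 2) * Real.exp (2 * a * t)) := fun t => by
    rw [gaussianRatio, ← ENNReal.ofReal_pow (Real.exp_nonneg _), ← Real.exp_nat_mul,
      ← Real.exp_add]
    congr 2
    simp
    ring
  simp_rw [e]
  rw [← ofReal_integral_eq_lintegral_ofReal (hint.const_mul _)
    (.of_forall fun t => by positivity), integral_const_mul]
  simp only [mgf, id] at hmgf
  rw [hmgf, ← Real.exp_add]
  congr 2
  simp
  ring

theorem integral_gaussianLaw : ∫ z, z ∂gaussianLaw = 0 := by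
  rw [gaussianLaw, integral_map Complex.measurable_ofReal.aemeasurable
    (f := fun z => z) aestronglyMeasurable_id, integral_complex_ofReal, integral_id_gaussianReal]
  simp

theorem lintegral_enorm_sq_gaussianLaw : ∫⁻ z, ‖z‖ₑ ^ 2 ∂gaussianLaw = 1 := by
  rw [gaussianLaw, lintegral_map (by fun_prop) Complex.measurable_ofReal]
  have hm : MemLp id 2 (gaussianReal 0 1) := memLp_id_gaussianReal 2
  have hv := variance_id_gaussianReal (μ := 0) (v := 1)
  rw [variance_of_integral_eq_zero aemeasurable_id (by simp [integral_id_gaussianReal])] at hv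
  have e : ∀ t : ℝ, ‖(t : ℂ)‖ₑ ^ 2 = ENNReal.ofReal (t ^ 2) := fun t => by
    rw [← ofReal_norm, Complex.norm_real, ← ENNReal.ofReal_pow (norm_nonneg _)]
    simp
  simp_rw [e]
  simp only [id] at hv
  rw [← ofReal_integral_eq_lintegral_ofReal (f := fun t : ℝ => t ^ 2) hm.integrable_sq
    (.of_forall fun t => sq_nonneg t)]
  rw [hv]
  simp

end Gaussian

/-! ### The hard instance -/

section Block

/-- The measure on `Fin (d + 1)` giving mass `1 / K` to each point other than `0` and the remaining
mass `1 - d / K` to `0`. -/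
noncomputable def blockMeasure (d : ℕ) (K : ℝ) : Measure (Fin (d + 1)) :=
  ∑ i, (Fin.cons (ENNReal.ofReal (1 - d / K)) fun _ => ENNReal.ofReal (1 / K) :
    Fin (d + 1) → ℝ≥0∞) i • Measure.dirac i

/-- The functions on `Fin (d + 1)` that vanish at `0`. -/
noncomputable def blockFamily (d : ℕ) : Submodule ℂ (Fin (d + 1) → ℂ) :=
  LinearMap.ker (LinearMap.proj 0 : (Fin (d + 1) → ℂ) →ₗ[ℂ] ℂ)

/-- Standard Gaussian noise at the point `1` and no noise elsewhere. -/
noncomputable def blockNoise (d : ℕ) : Kernel (Fin (d + 2)) ℂ :=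
  Kernel.ofFunOfCountable fun x => if x = 1 then gaussianLaw else Measure.dirac 0

theorem mem_blockFamily {d : ℕ} {f : Fin (d + 1) → ℂ} : f ∈ blockFamily d ↔ f 0 = 0 := by
  simp [blockFamily]

theorem finrank_blockFamily (d : ℕ) : Module.finrank ℂ (blockFamily d) = d := by
  have h := LinearMap.finrank_range_add_finrank_ker
    (LinearMap.proj 0 : (Fin (d + 1) → ℂ) →ₗ[ℂ] ℂ)
  rw [LinearMap.range_eq_top.2 (LinearMap.proj_surjective 0)] at h
  simp at h
  unfold blockFamily
  omega

theorem blockNoise_one (d : ℕ) : blockNoise d 1 = gaussianLaw := by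
  simp [blockNoise, Kernel.ofFunOfCountable]

theorem blockNoise_of_ne {d : ℕ} {x : Fin (d + 2)} (hx : x ≠ 1) :
    blockNoise d x = Measure.dirac 0 := by
  simp [blockNoise, Kernel.ofFunOfCountable, hx]

instance (d : ℕ) : IsMarkovKernel (blockNoise d) where
  isProbabilityMeasure x := by
    by_cases hx : x = 1
    · rw [hx, blockNoise_one]; infer_instance
    · rw [blockNoise_of_ne hx]; infer_instance

theorem blockMeasure_singleton_zero (d : ℕ) (K : ℝ) :
    blockMeasure d K {0} = ENNReal.ofReal (1 - d / K) := by
  simp [blockMeasure, Fin.sum_univ_succ]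

theorem blockMeasure_singleton_succ (d : ℕ) (K : ℝ) (i : Fin d) :
    blockMeasure d K {i.succ} = ENNReal.ofReal (1 / K) := by
  simp [blockMeasure, Fin.sum_univ_succ, Set.indicator, Fin.succ_ne_zero, eq_comm]

theorem lintegral_blockMeasure (d : ℕ) (K : ℝ) (φ : Fin (d + 1) → ℝ≥0∞) :
    ∫⁻ x, φ x ∂blockMeasure d K =
      φ 0 * ENNReal.ofReal (1 - d / K) + ∑ i : Fin d, φ i.succ * ENNReal.ofReal (1 / K) := by
  rw [lintegral_fintype, Fin.sum_univ_succ]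
  simp_rw [blockMeasure_singleton_succ, blockMeasure_singleton_zero]

variable {d : ℕ} {K : ℝ}

theorem isProbabilityMeasure_blockMeasure (hK : 0 < K) (hd : (d : ℝ) ≤ K) :
    IsProbabilityMeasure (blockMeasure d K) := by
  constructor
  have h := lintegral_blockMeasure d K fun _ => 1
  rw [lintegral_one] at h
  rw [h]
  simp only [one_mul, Finset.sum_const, Finset.card_univ, Fintype.card_fin, nsmul_eq_mul]
  rw [← ENNReal.ofReal_natCast d, ← ENNReal.ofReal_mul (Nat.cast_nonneg d),
    ← ENNReal.ofReal_add (sub_nonneg.2 ((div_le_one hK).2 hd)) (by positivity)]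
  simp [div_eq_mul_inv]

theorem normD_sq {G : Type*} [MeasurableSpace G] (D : Measure G) (h : G → ℂ) :
    normD D h ^ 2 = ∫⁻ x, ‖h x‖ₑ ^ 2 ∂D := by
  have := eLpNorm_nnreal_pow_eq_lintegral (μ := D) (f := h) (p := 2) two_ne_zero
  simpa [normD] using this

/-- A single atom of mass `1 / K` already contributes this much to the norm. The bound serves twice:
for the condition number, and to turn an error in norm into an error at each atom. -/
theorem enorm_sq_le_normD_sq (hK : 0 < K) (h : Fin (d + 1) → ℂ) (i : Fin d) :
    ‖h i.succ‖ₑ ^ 2 ≤ ENNReal.ofReal K * normD (blockMeasure d K) h ^ 2 := by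
  rw [normD_sq, lintegral_blockMeasure]
  calc ‖h i.succ‖ₑ ^ 2 = ENNReal.ofReal K * (‖h i.succ‖ₑ ^ 2 * ENNReal.ofReal (1 / K)) := by
        rw [mul_left_comm, ← ENNReal.ofReal_mul hK.le, mul_one_div_cancel hK.ne']
        simp
    _ ≤ _ := by
        gcongr
        refine le_add_left ?_
        exact Finset.single_le_sum
          (f := fun i : Fin d => ‖h i.succ‖ₑ ^ 2 * ENNReal.ofReal (1 / K))
          (fun _ _ => zero_le) (Finset.mem_univ i)

theorem condNumber_block (hK : 0 < K) :
    condNumber (blockMeasure (d + 1) K) (blockFamily (d + 1)) = ENNReal.ofReal K := by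
  apply le_antisymm
  · refine iSup₂_le fun h hh => iSup_le fun _ => iSup_le fun x => ENNReal.div_le_of_le_mul ?_
    rw [mem_blockFamily] at hh
    induction x using Fin.cases with
    | zero => simp [hh]
    | succ i => exact enorm_sq_le_normD_sq hK h i
  -- The indicator of an atom has squared norm `1 / K`, so it attains the supremum.
  · have hmem : (Pi.single 1 1 : Fin (d + 2) → ℂ) ∈ blockFamily (d + 1) := by
      simp [mem_blockFamily]
    have hne : (Pi.single 1 1 : Fin (d + 2) → ℂ) ≠ 0 := by simp
    refine le_iSup₂_of_le _ hmem (le_iSup_of_le hne (le_iSup_of_le 1 ?_))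
    have e : ∫⁻ x, ‖(Pi.single 1 1 : Fin (d + 2) → ℂ) x‖ₑ ^ 2 ∂blockMeasure (d + 1) K =
        ENNReal.ofReal (1 / K) := by
      rw [lintegral_blockMeasure, Fin.sum_univ_succ]
      have h0 : ∀ i : Fin d, i.succ.succ ≠ 1 := fun i => by
        rw [← Fin.succ_zero_eq_one, Ne, Fin.succ_inj]; exact Fin.succ_ne_zero i
      simp [h0]
    rw [normD_sq, e, one_div, ENNReal.ofReal_inv_of_pos hK]
    simp

theorem noiseNorm_sq (hK : 0 < K) (hd : ((d + 1 : ℕ) : ℝ) ≤ K) :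
    noiseNorm (blockMeasure (d + 1) K) (blockNoise d) ^ 2 = ENNReal.ofReal (1 / K) := by
  have := isProbabilityMeasure_blockMeasure hK hd
  have h := eLpNorm_nnreal_pow_eq_lintegral (μ := blockMeasure (d + 1) K ⊗ₘ blockNoise d)
    (f := fun p : Fin (d + 2) × ℂ => p.2) (p := 2) two_ne_zero
  have h' : noiseNorm (blockMeasure (d + 1) K) (blockNoise d) ^ 2 =
      ∫⁻ p, ‖p.2‖ₑ ^ 2 ∂(blockMeasure (d + 1) K ⊗ₘ blockNoise d) := by
    simpa [noiseNorm] using h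
  rw [h', Measure.lintegral_compProd (by fun_prop), lintegral_blockMeasure, Fin.sum_univ_succ]
  have h0 : ∀ i : Fin d, i.succ.succ ≠ 1 := fun i => by
    rw [← Fin.succ_zero_eq_one, Ne, Fin.succ_inj]; exact Fin.succ_ne_zero i
  simp [blockNoise_of_ne (h0 _), blockNoise_of_ne (zero_ne_one (α := Fin (d + 2))),
    blockNoise_one, lintegral_enorm_sq_gaussianLaw]

theorem noiseNorm_block (hK : 0 < K) (hd : ((d + 1 : ℕ) : ℝ) ≤ K) :
    noiseNorm (blockMeasure (d + 1) K) (blockNoise d) = ENNReal.ofReal √(1 / K) := by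
  refine (ENNReal.pow_right_strictMono two_ne_zero).injective ?_
  rw [noiseNorm_sq hK hd, ← ENNReal.ofReal_pow (Real.sqrt_nonneg _), Real.sq_sqrt (by positivity)]

/-- The noise has mean zero at every point, so the inner integral vanishes whatever `h` is. -/
theorem noiseOrthogonal_block (hK : 0 < K) (hd : ((d + 1 : ℕ) : ℝ) ≤ K) :
    NoiseOrthogonal (blockMeasure (d + 1) K) (blockFamily (d + 1)) (blockNoise d) := by
  have := isProbabilityMeasure_blockMeasure hK hd
  have hfin : noiseNorm (blockMeasure (d + 1) K) (blockNoise d) < ∞ := by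
    rw [noiseNorm_block hK hd]; exact ENNReal.ofReal_lt_top
  refine ⟨hfin, fun h _ => ?_⟩
  have hL2 : MemLp (fun p : Fin (d + 2) × ℂ => p.2) 2 (blockMeasure (d + 1) K ⊗ₘ blockNoise d) :=
    ⟨measurable_snd.aestronglyMeasurable, hfin⟩
  have hint : Integrable (fun p : Fin (d + 2) × ℂ => conj (h p.1) * p.2)
      (blockMeasure (d + 1) K ⊗ₘ blockNoise d) := by
    refine (hL2.integrable one_le_two).bdd_mul (c := ∑ i, ‖h i‖) ?_ (.of_forall fun p => ?_)
    · exact Measurable.aestronglyMeasurable (by fun_prop)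
    · rw [RCLike.norm_conj]
      exact Finset.single_le_sum (f := fun i => ‖h i‖) (fun _ _ => norm_nonneg _)
        (Finset.mem_univ p.1)
  rw [Measure.integral_compProd hint]
  refine integral_eq_zero_of_ae (.of_forall fun x => ?_)
  simp only [Pi.zero_apply]
  by_cases hx : x = 1
  · rw [hx, blockNoise_one, integral_const_mul, integral_gaussianLaw, mul_zero]
  · rw [blockNoise_of_ne hx]; simp

/-- The functions within distance `ρ` of `f` at every point other than `0`. -/
def nearSet (f : Fin (d + 1) → ℂ) (ρ : ℝ) : Set (Fin (d + 1) → ℂ) :=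
  {f' | ∀ i : Fin d, ‖f' i.succ - f i.succ‖ ≤ ρ}

theorem measurableSet_nearSet (f : Fin (d + 1) → ℂ) (ρ : ℝ) : MeasurableSet (nearSet f ρ) := by
  have e : nearSet f ρ = ⋂ i : Fin d, {f' | ‖f' i.succ - f i.succ‖ ≤ ρ} := by
    ext; simp [nearSet]
  rw [e]
  exact .iInter fun i => measurableSet_le (by fun_prop) measurable_const

theorem disjoint_nearSet {f₁ f₂ : Fin (d + 1) → ℂ} {ρ : ℝ} (i : Fin d)
    (h : 2 * ρ < ‖f₁ i.succ - f₂ i.succ‖) : Disjoint (nearSet f₁ ρ) (nearSet f₂ ρ) := by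
  refine Set.disjoint_left.2 fun f' h₁ h₂ => ?_
  have := norm_sub_le_norm_sub_add_norm_sub (f₁ i.succ) (f' i.succ) (f₂ i.succ)
  rw [norm_sub_rev (f₁ i.succ) (f' i.succ)] at this
  linarith [h₁ i, h₂ i]

/-- The factor `K` lost in passing from norm to atoms cancels the factor `1 / K` in the squared
noise norm. -/
theorem Succeeds.le_nearSet (hK : 0 < K) {g : Kernel (Fin (d + 1)) ℂ} {ρ : ℝ} (hρ : 0 ≤ ρ) {m : ℕ}
    {A : Kernel (Fin m → Fin (d + 1) × ℂ) (Fin (d + 1) → ℂ)}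
    (hA : Succeeds (blockMeasure d K) (blockFamily d) g
      (ENNReal.ofReal ρ * ENNReal.ofReal √(1 / K)) A)
    {f : Fin (d + 1) → ℂ} (hf : f ∈ blockFamily d) :
    3 / 4 ≤ (labelledSamples (blockMeasure d K) g f m).bind A (nearSet f ρ) := by
  refine (hA f hf).trans (measure_mono fun f' hf' i => ?_)
  have h := enorm_sq_le_normD_sq hK (f' - f) i
  have h2 : ‖(f' - f) i.succ‖ₑ ^ 2 ≤ ENNReal.ofReal ρ ^ 2 :=
    calc _ ≤ _ := h
      _ ≤ ENNReal.ofReal K * (ENNReal.ofReal ρ * ENNReal.ofReal √(1 / K)) ^ 2 := by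
          gcongr; exact hf'
      _ = ENNReal.ofReal ρ ^ 2 := by
          rw [← ENNReal.ofReal_mul hρ, ← ENNReal.ofReal_pow (by positivity),
            ← ENNReal.ofReal_mul hK.le, mul_pow, Real.sq_sqrt (by positivity),
            ← ENNReal.ofReal_pow hρ]
          congr 1
          field_simp
  rw [ENNReal.pow_le_pow_left_iff two_ne_zero, ← ofReal_norm,
    ENNReal.ofReal_le_ofReal_iff hρ] at h2
  exact h2

/-! ### The lower bounds from coverage and from noise -/

variable {m : ℕ} {A : Kernel (Fin m → Fin (d + 2) × ℂ) (Fin (d + 2) → ℂ)} [IsMarkovKernel A]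
  {ρ a : ℝ}

/-- The function equal to `a` on the points indexed by `s` and to `0` elsewhere. -/
noncomputable def stepFun (a : ℝ) (s : Finset (Fin d)) : Fin (d + 1) → ℂ :=
  Fin.cons 0 fun i => if i ∈ s then (a : ℂ) else 0

/-- All step functions of height `a` are candidates. Two of them differ by `a > 2ρ` at some atom, so
their neighbourhoods are disjoint. The noise plays no role. -/
theorem Succeeds.half_le_real_seen (hK : 0 < K) (hd : (d : ℝ) ≤ K)
    {g : Kernel (Fin (d + 1)) ℂ} [IsMarkovKernel g] {m : ℕ}
    {A : Kernel (Fin m → Fin (d + 1) × ℂ) (Fin (d + 1) → ℂ)} [IsMarkovKernel A]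
    (hρ : 0 ≤ ρ) (ha : 2 * ρ < a)
    (hA : Succeeds (blockMeasure d K) (blockFamily d) g
      (ENNReal.ofReal ρ * ENNReal.ofReal √(1 / K)) A) :
    1 / 2 ≤ (Measure.pi fun _ : Fin m => blockMeasure d K ⊗ₘ g).real
      {ω | ∀ i : Fin d, ∃ j, ω j ∈ ({i.succ} ×ˢ Set.univ : Set (Fin (d + 1) × ℂ))} := by
  classical
  have := isProbabilityMeasure_blockMeasure hK hd
  refine half_le_of_identifies (Θ := Finset (Fin d)) _
    (fun s ω j => ((ω j).1, stepFun a s (ω j).1 + (ω j).2)) (fun s => ?_) A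
    (fun s => nearSet (stepFun a s) ρ) (fun s => measurableSet_nearSet _ _) (fun s t hst => ?_)
    (measurableSet_forall_exists_mem fun i => (measurableSet_singleton _).prod .univ)
    (fun ω hω => ?_) fun s => ?_
  · exact measurable_pi_lambda _ fun j =>
      (measurable_shift (Measurable.of_discrete)).comp (measurable_pi_apply j)
  · obtain ⟨i, hi⟩ : ∃ i, ¬ (i ∈ s ↔ i ∈ t) := by
      by_contra! h; exact hst (Finset.ext h)
    refine disjoint_nearSet i ?_
    have habs : 2 * ρ < |a| := ha.trans_le (le_abs_self a)
    by_cases h1 : i ∈ s <;> by_cases h2 : i ∈ t <;> simp_all [stepFun]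
  · simp only [Set.mem_ofPred_eq, not_forall, not_exists] at hω
    obtain ⟨i, hi⟩ := hω
    -- The involution toggles the unseen atom `i`.
    refine ⟨fun s => symmDiff s {i}, fun s => symmDiff_symmDiff_cancel_right _ _,
      fun s h => ?_, fun s => ?_⟩
    · exact Finset.singleton_ne_empty i (symmDiff_eq_left.1 h)
    · funext j
      have hj : (ω j).1 ≠ i.succ := by simpa using hi j
      have e : stepFun a (symmDiff s {i}) (ω j).1 = stepFun a s (ω j).1 := by
        generalize (ω j).1 = x at hj
        induction x using Fin.cases with
        | zero => rfl
        | succ k =>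
          have hk : k ≠ i := fun h => hj (h ▸ rfl)
          simp [stepFun, Finset.mem_symmDiff, hk]
      rw [e]
  · rw [← labelledSamples_eq_map _ _ Measurable.of_discrete]
    exact hA.le_nearSet hK hρ (by simp [mem_blockFamily, stepFun])

theorem compProd_real_singleton_succ (hK : 0 < K) (hd : (d : ℝ) ≤ K)
    (g : Kernel (Fin (d + 1)) ℂ) [IsMarkovKernel g] (i : Fin d) :
    (blockMeasure d K ⊗ₘ g).real ({i.succ} ×ˢ Set.univ) = 1 / K := by
  have := isProbabilityMeasure_blockMeasure hK hd
  rw [measureReal_def, Measure.compProd_apply_prod (measurableSet_singleton _) .univ]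
  simp [blockMeasure_singleton_succ, hK.le]

theorem Succeeds.half_mul_le (hK : 0 < K) (hd : ((d + 1 : ℕ) : ℝ) ≤ K)
    (hρ : 0 ≤ ρ) (ha : 2 * ρ < a)
    (hA : Succeeds (blockMeasure (d + 1) K) (blockFamily (d + 1)) (blockNoise d)
      (ENNReal.ofReal ρ * ENNReal.ofReal √(1 / K)) A) :
    K / 2 ≤ m ∧ K * Real.log (d + 1 : ℕ) / 2 ≤ m := by
  have := isProbabilityMeasure_blockMeasure hK hd
  have h := hA.half_le_real_seen hK hd hρ ha
  constructor
  · have h1 := h.trans (pi_real_forall_exists_mem_le _ m 0)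
    rw [compProd_real_singleton_succ hK hd, mul_one_div, le_div_iff₀ hK] at h1
    linarith
  -- In dimension one the logarithm is zero, and `K = 1` is possible, which would make `1 - 1 / K`
  -- vanish. Otherwise `K ≥ 2`.
  · rcases Nat.eq_zero_or_pos d with rfl | hd0
    · simp
    have hd2 : (2 : ℝ) ≤ (d + 1 : ℕ) := by exact_mod_cast Nat.succ_le_succ hd0
    have hK2 : 2 ≤ K := hd2.trans hd
    have h1 := h.trans (coupon_collector _ m
      (fun i => (measurableSet_singleton _).prod .univ)
      (fun i k hik => Set.disjoint_prod.2 (.inl (Set.disjoint_singleton.2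
        fun e => hik (Fin.succ_injective _ e))))
      (compProd_real_singleton_succ hK hd (blockNoise d)) ((div_le_one hK).2 (by linarith)))
    rw [Fintype.card_fin] at h1
    have hpos : 0 < 1 - 1 / K := by
      rw [sub_pos, div_lt_one hK]; linarith
    rw [one_div_le_one_div (by norm_num) (by positivity)] at h1
    have h2 : Real.log ((d + 1 : ℕ) * (1 - 1 / K) ^ m) ≤ 0 :=
      Real.log_nonpos (by positivity) (by linarith)
    rw [Real.log_mul (by positivity) (by positivity), Real.log_pow] at h2
    -- From `log x ≥ 1 - 1/x` and `1 / (K - 1) ≤ 2 / K`, the latter because `K ≥ 2`.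
    have h3 : -(2 / K) ≤ Real.log (1 - 1 / K) := by
      refine le_trans ?_ (Real.one_sub_inv_le_log_of_pos hpos)
      have e : 1 - (1 - 1 / K)⁻¹ = -(1 / (K - 1)) := by
        have : K - 1 ≠ 0 := by linarith
        field_simp
        ring
      rw [e, neg_le_neg_iff, div_le_div_iff₀ (by linarith) hK]
      linarith
    have h4 : Real.log (d + 1 : ℕ) ≤ m * (2 / K) := by
      nlinarith [mul_le_mul_of_nonneg_left h3 (Nat.cast_nonneg m : (0 : ℝ) ≤ m)]
    rw [mul_div_assoc', le_div_iff₀ hK] at h4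
    linarith

/-- A second moment test of `0` against height `a` at the noisy atom: only samples landing there, a
fraction `1 / K`, carry information. The exponential comes from `1 + x ≤ exp x`. -/
theorem Succeeds.nine_fourths_le_exp (hK : 0 < K) (hd : ((d + 1 : ℕ) : ℝ) ≤ K)
    (hρ : 0 ≤ ρ) (ha : 2 * ρ < a)
    (hA : Succeeds (blockMeasure (d + 1) K) (blockFamily (d + 1)) (blockNoise d)
      (ENNReal.ofReal ρ * ENNReal.ofReal √(1 / K)) A) :
    9 / 4 ≤ Real.exp (m * ((Real.exp (a ^ 2) - 1) / K)) := by
  have := isProbabilityMeasure_blockMeasure hK hd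
  set D := blockMeasure (d + 1) K
  set f : Fin (d + 2) → ℂ := Pi.single 1 (a : ℂ)
  have hf : f ∈ blockFamily (d + 1) := by simp [mem_blockFamily, f]
  set L : Fin (d + 2) × ℂ → ℝ≥0∞ := fun p => if p.1 = 1 then gaussianRatio a p.2 else 1
  have hL : Measurable L := Measurable.ite (measurable_fst (measurableSet_singleton _))
    ((measurable_gaussianRatio a).comp measurable_snd) measurable_const
  have hsample : labelledSample D (blockNoise d) f = (D ⊗ₘ blockNoise d).withDensity L := by
    refine labelledSample_eq_withDensity _ _ Measurable.of_discrete hL fun x => ?_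
    by_cases hx : x = 1
    · subst hx
      simpa [f, L, blockNoise_one] using gaussianLaw_map_add a
    · simp only [f, L, hx, if_false, Pi.single_eq_of_ne hx]
      simp
  have : IsProbabilityMeasure ((D ⊗ₘ blockNoise d).withDensity L) := by
    rw [← hsample]
    exact Measure.isProbabilityMeasure_map (measurable_shift .of_discrete).aemeasurable
  have h₁ := hA.le_nearSet hK hρ (f := 0) (zero_mem _)
  have h₂ := hA.le_nearSet hK hρ hf
  rw [labelledSamples, labelledSample_zero] at h₁
  rw [labelledSamples, hsample, pi_withDensity _ _ hL] at h₂
  have hdisj : Disjoint (nearSet (0 : Fin (d + 2) → ℂ) ρ) (nearSet f ρ) := by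
    refine disjoint_nearSet 0 ?_
    simpa [f, abs_of_nonneg (show 0 ≤ a by linarith)] using ha
  have hLm : Measurable fun ω : Fin m → Fin (d + 2) × ℂ => ∏ j, L (ω j) :=
    Finset.measurable_prod _ fun j _ => hL.comp (measurable_pi_apply j)
  have h := nine_fourths_le_lintegral_sq _ A _ hLm
    (measurableSet_nearSet 0 ρ) (measurableSet_nearSet f ρ) hdisj h₁ h₂
  simp only [← Finset.prod_pow] at h
  rw [lintegral_pi_prod (D ⊗ₘ blockNoise d) (fun _ p => L p ^ 2) fun _ => hL.pow_const 2] at h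
  have hexp : 0 ≤ Real.exp (a ^ 2) - 1 := sub_nonneg.2 (Real.one_le_exp (sq_nonneg a))
  have hL2 : ∫⁻ p, L p ^ 2 ∂(D ⊗ₘ blockNoise d) =
      ENNReal.ofReal (1 + (Real.exp (a ^ 2) - 1) / K) := by
    rw [Measure.lintegral_compProd (hL.pow_const 2)]
    have hx : ∀ x, ∫⁻ z, L (x, z) ^ 2 ∂blockNoise d x =
        1 + ({1} : Set (Fin (d + 2))).indicator
          (fun _ => ENNReal.ofReal (Real.exp (a ^ 2) - 1)) x := fun x => by
      by_cases hx : x = 1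
      · subst hx
        simp only [L, if_true, blockNoise_one, lintegral_gaussianRatio_sq, Set.mem_singleton_iff,
          Set.indicator_of_mem]
        rw [← ENNReal.ofReal_one, ← ENNReal.ofReal_add zero_le_one hexp]
        congr 1
        ring
      · simp [L, hx]
    simp_rw [hx]
    rw [lintegral_add_left measurable_const, lintegral_indicator_const (measurableSet_singleton _),
      lintegral_one, measure_univ, ← Fin.succ_zero_eq_one, blockMeasure_singleton_succ,
      ← ENNReal.ofReal_mul hexp, ← ENNReal.ofReal_one, ← ENNReal.ofReal_add zero_le_one
        (by positivity), mul_one_div]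
  rw [hL2, Finset.prod_const, Finset.card_univ, Fintype.card_fin,
    ← ENNReal.ofReal_pow (by positivity)] at h
  have e94 : (9 / 4 : ℝ≥0∞) = ENNReal.ofReal (9 / 4) := by
    rw [ENNReal.ofReal_div_of_pos (by norm_num)]; norm_num
  rw [e94, ENNReal.ofReal_le_ofReal_iff (by positivity)] at h
  refine h.trans ?_
  rw [Real.exp_nat_mul]
  refine pow_le_pow_left₀ (by positivity) ?_ m
  rw [add_comm]
  exact Real.add_one_le_exp _

end Block

end ActiveRegression

/-! ### Assembling the two bounds -/

open ActiveRegression in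
theorem mainTheorem7 :
    ∃ c : ℝ, 0 < c ∧
      ∀ (d : ℕ) (K ε : ℝ), 1 ≤ d → (d : ℝ) ≤ K → 0 < ε →
        ∃ (n : ℕ) (D : Measure (Fin n)) (F : Submodule ℂ (Fin n → ℂ)) (g : Kernel (Fin n) ℂ),
          IsProbabilityMeasure D ∧
          Module.finrank ℂ F = d ∧
          ActiveRegression.condNumber D F = ENNReal.ofReal K ∧
          IsMarkovKernel g ∧
          ActiveRegression.NoiseOrthogonal D F g ∧
          0 < ActiveRegression.noiseNorm D g ∧
          ∀ (m : ℕ) (A : Kernel (Fin m → Fin n × ℂ) (Fin n → ℂ)), IsMarkovKernel A →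
            ActiveRegression.Succeeds D F g
              (ENNReal.ofReal (0.1 * √ε) * ActiveRegression.noiseNorm D g) A →
            c * (K * Real.log d + K / ε) ≤ m := by
  -- Each of `K log d` and `K / ε` will be at most `2m`, so a quarter of their sum is at most `m`.
  refine ⟨1 / 4, by norm_num, fun d K ε hd1 hdK hε => ?_⟩
  obtain ⟨d, rfl⟩ := Nat.exists_eq_add_of_le' hd1
  have hK : 0 < K := lt_of_lt_of_le (by exact_mod_cast Nat.succ_pos d) hdK
  refine ⟨d + 2, blockMeasure (d + 1) K, blockFamily (d + 1), blockNoise d,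
    isProbabilityMeasure_blockMeasure hK hdK, finrank_blockFamily _, condNumber_block hK,
    inferInstance, noiseOrthogonal_block hK hdK, ?_, fun m A _ hA => ?_⟩
  · rw [noiseNorm_block hK hdK]
    exact ENNReal.ofReal_pos.2 (by positivity)
  rw [noiseNorm_block hK hdK] at hA
  have hρ : 0 ≤ 0.1 * √ε := by positivity
  -- The height `a = √ε / 4` just exceeds twice the allowed error `0.1 √ε`.
  have ha : 2 * (0.1 * √ε) < √ε / 4 := by
    have := Real.sqrt_pos.2 hε
    linarith
  obtain ⟨h1, h2⟩ := hA.half_mul_le hK hdK hρ ha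
  suffices h3 : K / ε / 2 ≤ m by linarith
  -- For `ε ≥ 1` the bound `K / 2 ≤ m` is enough; the noise is needed only for `ε ≤ 1`, where `exp
  -- (ε / 16) - 1` is linear in `ε` up to a constant.
  rcases le_total 1 ε with hε1 | hε1
  · have : K / ε ≤ K := div_le_self hK.le hε1
    linarith
  have h := hA.nine_fourths_le_exp hK hdK hρ ha
  have hsq : (√ε / 4) ^ 2 = ε / 16 := by
    rw [div_pow, Real.sq_sqrt hε.le]; norm_num
  rw [hsq] at h
  have hexp : Real.exp (ε / 16) - 1 ≤ ε / 8 := by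
    have := Real.exp_bound_div_one_sub_of_interval (x := ε / 16) (by positivity) (by linarith)
    have h' : 1 / (1 - ε / 16) ≤ 1 + ε / 8 := by
      rw [div_le_iff₀ (by linarith)]; nlinarith
    linarith
  have hle : (9 / 4 : ℝ) ≤ Real.exp (m * (ε / 8 / K)) := h.trans (by gcongr)
  have hhalf : 1 / 2 ≤ m * (ε / 8 / K) := by
    by_contra! hlt
    -- Squaring would give `81 / 16 ≤ e`, which is false.
    have hs : (9 / 4 : ℝ) ≤ Real.exp (1 / 2) := hle.trans (Real.exp_le_exp.2 hlt.le)
    have hs2 : Real.exp (1 / 2) ^ 2 = Real.exp 1 := by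
      rw [← Real.exp_nat_mul]; norm_num
    nlinarith [Real.exp_one_lt_d9]
  have : K * (1 / 2) ≤ m * ε / 8 := by
    calc K * (1 / 2) ≤ K * (m * (ε / 8 / K)) := by gcongr
      _ = m * ε / 8 := by field_simp
  rw [div_div, div_le_iff₀ (by positivity)]
  nlinarith [mul_nonneg (Nat.cast_nonneg m : (0 : ℝ) ≤ m) hε.le]
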